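/- Let $n\ge 3$, $m\ge 0$, and write $x=(x_1,x')\in\mathbb R\times\mathbb R^{n-1}$, with Cartesian components of tensors indexed by $1,\dots,n$. Let $f(x_1,x')$ be a complex symmetric $m$-tensor field on $\mathbb R^n$, supported in the variable $x'$ in a compact set $K\subset\mathbb R^{n-1}$ (that is, $f(x_1,x')=0$ for all $x_1$ and all $x'\notin K$), with $f(0,\cdot)$ integrable. For a centre $x_0\in\mathbb R^{n-1}$ use polar coordinates $x'=x_0+r\theta$, $r>0$, $\theta\in\mathbb S^{n-2}$, and put $e_r=(0,\theta)$, $e_1=(1,0,\dots,0)$. Assume that for every centre $x_0\notin K$, every $0\le\alpha\le m$ and a.e. $\theta\in\mathbb S^{n-2}$, $$\int_0^\infty r^\alpha \sum_{i_1,\dots,i_m=1}^n f_{i_1\cdots i_m}(0,x_0+r\theta)\prod_{j=1}^m (e_1+\mathrm i\,e_r)_{i_j}\,dr=0 .$$ For a symmetric tensor $t$ of order $q$ let $(i_\delta t)_{i_1\cdots i_{q+2}}$ be the average of $t_{i_1\cdots i_q}\delta_{i_{q+1}i_{q+2}}$ over all permutations of the indices $i_1,\dots,i_{q+2}$. Then: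 1. If $m\in\{0,1\}$, then $f(0,x')=0$ for a.e. $x'$, and at every point $x'$ at which $f(0,\cdot)$ is continuous. 2. If $m\ge 2$, there is a symmetric $(m-2)$-tensor field $v$ on $\mathbb R^n$, supported in $K$ in the variable $x'$ and with $v(0,\cdot)$ integrable, such that $f(0,x')=i_\delta v(0,x')$ for a.e. $x'$, and at every point $x'$ at which $f(0,\cdot)$ is continuous. Moreover $v$ can be chosen so that, at every point $(x_1,x')$, for $0\le p\le m-2$ and $2\le i_1,\dots,i_p\le n$, $$v_{i_1\cdots i_p1\cdots1}=\binom{m-2}{m-p-2}^{-1}\Big(\sum_{l=1}^{[\frac{p+2}2]}(-1)^{l-1}\,i_\delta^{\,l-1}\tilde f^{\,p+2-2l}\Big)_{i_1\cdots i_p},$$ where $\tilde f^{\,q}_{i_1\cdots i_q}=\binom mq f_{i_1\cdots i_q1\cdots1}$ ($2\le i_1,\dots,i_q\le n$) is regarded as a symmetric $q$-tensor on $\mathbb R^{n-1}$, and $i_\delta$ in this formula acts on tensors on $\mathbb R^{n-1}$. -/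

import Mathlib

open MeasureTheory

/-- Complex tensors of order `m`, given by their Cartesian components; `ι` is the range of each
index. -/
abbrev Tensor (ι : Type) (m : ℕ) : Type := (Fin m → ι) → ℂ

/-- The tensor `t` is symmetric in its indices. -/
def Tensor.IsSymmetric {ι : Type} {m : ℕ} (t : Tensor ι m) : Prop :=
  ∀ (π : Equiv.Perm (Fin m)) (i : Fin m → ι), t (i ∘ π) = t i

/-- `(i_δ t)_{i₁⋯i_{m+2}} = σ(i₁⋯i_{m+2}) t_{i₁⋯i_m} δ_{i_{m+1} i_{m+2}}`, where `σ` is the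
average over all permutations of the indices. -/
noncomputable def Tensor.iDelta {ι : Type} [DecidableEq ι] {m : ℕ} (t : Tensor ι m) :
    Tensor ι (m + 2) := fun i =>
  ((m + 2).factorial : ℂ)⁻¹ * ∑ π : Equiv.Perm (Fin (m + 2)),
    t (fun j => i (π (Fin.castAdd 2 j))) *
      (if i (π (Fin.natAdd m 0)) = i (π (Fin.natAdd m 1)) then 1 else 0)

/-- The `l`-fold composition of `i_δ` with itself. -/
noncomputable def Tensor.iDeltaPow {ι : Type} [DecidableEq ι] {m : ℕ} (t : Tensor ι m) :
    (l : ℕ) → Tensor ι (m + 2 * l)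
  | 0 => t
  | l + 1 => (Tensor.iDeltaPow t l).iDelta

/-- The full contraction `∑ t_{i₁⋯i_m} ζ_{i₁} ⋯ ζ_{i_m}`. -/
noncomputable def Tensor.contract {ι : Type} [Fintype ι] {m : ℕ} (t : Tensor ι m) (ζ : ι → ℂ) :
    ℂ :=
  ∑ i : Fin m → ι, t i * ∏ j, ζ (i j)

/-- The multi-index `(i₁, …, i_p, 1, …, 1)` of length `m`. The coordinates of `ℝ × ℝ^d` are
numbered by `Fin (d + 1)`: the first coordinate `x₁` has number `0`, and the `k`-th coordinate
of `x' ∈ ℝ^d` has number `k.succ`. -/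
def padIndex {d p : ℕ} (m : ℕ) (i : Fin p → Fin d) : Fin m → Fin (d + 1) := fun j =>
  if h : (j : ℕ) < p then (i ⟨j, h⟩).succ else 0

/-- `f̃^q = binom(m, q) f_{i₁⋯i_q 1⋯1}`, a tensor of order `q` on `ℝ^d`. -/
noncomputable def Tensor.tilde {d m : ℕ} (f : Tensor (Fin (d + 1)) m) (q : ℕ) :
    Tensor (Fin d) q := fun i =>
  (m.choose q : ℂ) * f (padIndex m i)

/-- The vector `e₁ + i e_r` of `ℂ^{d+1}` in the direction `e_r = θ ∈ ℝ^d`. -/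
noncomputable def complexDirection {d : ℕ} (θ : EuclideanSpace ℝ (Fin d)) : Fin (d + 1) → ℂ :=
  Fin.cons 1 (fun j => Complex.I * (θ j : ℂ))

/-- `f(x₁, x')` is a symmetric `m`-tensor field on `ℝ × ℝ^d`, supported in `K` in the variable
`x'`, whose slice `x₁ = 0` is integrable. -/
structure IsTensorField {d m : ℕ} (K : Set (EuclideanSpace ℝ (Fin d)))
    (f : ℝ → EuclideanSpace ℝ (Fin d) → Tensor (Fin (d + 1)) m) : Prop where
  symmetric : ∀ x₁ x', (f x₁ x').IsSymmetric
  support : ∀ x₁ x', x' ∉ K → f x₁ x' = 0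
  integrable : Integrable (f 0) volume

/-- The sum `∑_{l=1}^{[(p+2)/2]} (-1)^{l-1} i_δ^{l-1} f̃^{p+2-2l}`, a tensor of order `p` on
`ℝ^d`; the summation variable is `j = l - 1`, which runs over `0 ≤ j ≤ [p/2]`. -/
noncomputable def Tensor.alternatingSum {d m : ℕ} (f : Tensor (Fin (d + 1)) m) (p : ℕ) :
    Tensor (Fin d) p := fun i =>
  ∑ j : Fin (p / 2 + 1), (-1 : ℂ) ^ (j : ℕ) *
    (f.tilde (p - 2 * (j : ℕ))).iDeltaPow (j : ℕ) (i ∘ Fin.cast (by omega))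

/-- The moment of order `α` of `f(0, ·)` contracted with `(e₁ + i e_r)^{⊗ m}`, along the ray
`x' = x₀ + r θ`, in polar coordinates `(r, θ)` of `ℝ^d` centred at `x₀`. -/
noncomputable def rayMoment {d m : ℕ}
    (f : ℝ → EuclideanSpace ℝ (Fin d) → Tensor (Fin (d + 1)) m)
    (x₀ : EuclideanSpace ℝ (Fin d)) (α : ℕ) (θ : EuclideanSpace ℝ (Fin d)) : ℂ :=
  ∫ r in Set.Ioi (0 : ℝ), (r : ℂ) ^ α * (f 0 (x₀ + r • θ)).contract (complexDirection θ)

/-! Let `θ` be a unit vector and `g` the contraction of `f(0, ·)` with `(e₁ + i θ)^{⊗ m}`. Every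
line of direction `θ` meets the slab `-(R + 1) ≤ ⟨y, θ⟩ < -R`, which lies outside the ball of
radius `R` containing the support. The vanishing moments of order `≤ m` along the rays issuing
from the slab cancel the Taylor polynomial of degree `m` of the exponential on each line, so that
`ĝ(ξ) = O(|⟨θ, ξ⟩|^{m + 1})` uniformly in `θ`.

On the other hand `ĝ(ξ)` is the contraction of `f̂(ξ)` with `(e₁ + i θ)^{⊗ m}`. Parametrize `θ` by
stereographic projection from a pole orthogonal to `ξ`, along a line `t ↦ t w`. Then `⟨θ, ξ⟩` is a
multiple of `t / D(t)` with `D(t) = |w|² t² + 4`, and `ĝ(ξ) = Q(t) / D(t)^m` with a polynomial `Q`.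
Hence `Q D = O(|t|^{m + 1})` on the whole real line, which makes `Q D` a multiple of `t^{m + 1}`;
as `D` has a root different from `0`, `Q = 0`. So `f̂(ξ)`, and by Fourier inversion `f(0, x')` for
a.e. `x'`, vanishes on all `e₁ + i θ`.

Finally, the form `∑ t_{i₁⋯i_m} ζ_{i₁} ⋯ ζ_{i_m}` of a symmetric tensor is, modulo `ζ₁² + |ζ'|²`,
affine in `ζ₁`; the quotient and the two coefficients of the remainder are alternating sums of the
`t̃^q`. Vanishing on all `e₁ ± i θ` kills the remainder, and the quotient is the form of `v`.
-/

theorem exists_perm_comp_eq_of_ofFn_perm {ι : Type} {m : ℕ} {i j : Fin m → ι}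
    (h : (List.ofFn i).Perm (List.ofFn j)) : ∃ π : Equiv.Perm (Fin m), j ∘ π = i := by
  classical
  let e := finCongr (List.length_ofFn (f := i))
  let e' := finCongr (List.length_ofFn (f := j))
  refine ⟨e.symm.trans ((Equiv.ofBijective h.idxBij
    ⟨h.idxBij_injective, h.idxBij_surjective⟩).trans e'), funext fun a => ?_⟩
  have := h.getElem_idxBij_eq_getElem (e.symm a)
  simp only [List.getElem_ofFn] at this
  exact this

theorem ofFn_perm_of_sum_single_eq {ι : Type} {m : ℕ} {i j : Fin m → ι}
    (h : ∑ k, Finsupp.single (i k) 1 = ∑ k, Finsupp.single (j k) 1) :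
    (List.ofFn i).Perm (List.ofFn j) := by
  have toMultiset_eq (i : Fin m → ι) :
      Finsupp.toMultiset (∑ k, Finsupp.single (i k) 1) = List.ofFn i := by
    simp only [map_sum, Finsupp.toMultiset_single, one_smul, ← Fin.univ_val_map]
    exact Multiset.bind_singleton _ i
  rw [← Multiset.coe_eq_coe, ← toMultiset_eq, ← toMultiset_eq, h]

namespace Tensor

section Contraction

variable {ι : Type} [Fintype ι] {m : ℕ}

/-- The full contraction `t ↦ ∑ t_{i₁⋯i_m} ζ_{i₁} ⋯ ζ_{i_m}` with a fixed vector `ζ` as a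
continuous linear form in the tensor. -/
noncomputable def contractCLM (ζ : ι → ℂ) : Tensor ι m →L[ℂ] ℂ :=
  ∑ i : Fin m → ι, (∏ j, ζ (i j)) • ContinuousLinearMap.proj i

@[simp]
theorem contractCLM_apply (ζ : ι → ℂ) (t : Tensor ι m) : contractCLM ζ t = t.contract ζ := by
  simp [contractCLM, contract, mul_comm]

theorem contract_const_mul (c : ℂ) (t : Tensor ι m) (ζ : ι → ℂ) :
    contract (fun i => c * t i) ζ = c * t.contract ζ := by
  simp only [contract, Finset.mul_sum, mul_assoc]

@[simp]
theorem zero_contract (ζ : ι → ℂ) : (0 : Tensor ι m).contract ζ = 0 := by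
  simp [contract]

theorem contract_sub (s t : Tensor ι m) (ζ : ι → ℂ) :
    (s - t).contract ζ = s.contract ζ - t.contract ζ := by
  simpa only [contractCLM_apply] using (contractCLM ζ).map_sub s t

theorem contract_finsetSum {κ : Type*} (s : Finset κ) (t : κ → Tensor ι m) (ζ : ι → ℂ) :
    contract (fun i => ∑ k ∈ s, t k i) ζ = ∑ k ∈ s, (t k).contract ζ := by
  simpa only [contractCLM_apply, ← Finset.sum_apply] using map_sum (contractCLM ζ) t s

theorem contract_smul (t : Tensor ι m) (c : ℂ) (ζ : ι → ℂ) :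
    t.contract (c • ζ) = c ^ m * t.contract ζ := by
  simp [contract, Finset.prod_mul_distrib, Finset.mul_sum, mul_left_comm]

theorem contract_comp_perm (t : Tensor ι m) (π : Equiv.Perm (Fin m)) (ζ : ι → ℂ) :
    contract (fun i => t (i ∘ π)) ζ = t.contract ζ := by
  simp only [contract]
  rw [← (Equiv.arrowCongr π (Equiv.refl ι)).sum_comp]
  refine Finset.sum_congr rfl fun i _ => ?_
  rw [← Equiv.prod_comp π]
  simp [Equiv.arrowCongr, Function.comp_def]

theorem contract_comp_cast {n : ℕ} (h : n = m) (t : Tensor ι n) (ζ : ι → ℂ) :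
    contract (fun i : Fin m → ι => t (i ∘ Fin.cast h)) ζ = t.contract ζ := by
  subst h
  rfl

theorem contract_zero_order (t : Tensor ι 0) (ζ : ι → ℂ) (i : Fin 0 → ι) :
    t.contract ζ = t i := by
  simp [contract, Subsingleton.elim default i]

theorem contract_succ (t : Tensor ι (m + 1)) (ζ : ι → ℂ) :
    t.contract ζ = ∑ a, ζ a * contract (fun i => t (Fin.cons a i)) ζ := by
  rw [contract, ← (Fin.consEquiv fun _ => ι).sum_comp, Fintype.sum_prod_type]
  simp [Fin.consEquiv, Fin.prod_univ_succ, contract, Finset.mul_sum, mul_left_comm]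

theorem continuous_contract : Continuous fun p : Tensor ι m × (ι → ℂ) => p.1.contract p.2 := by
  unfold contract
  fun_prop

end Contraction

section MetricProduct

variable {ι : Type} [DecidableEq ι] {m : ℕ}

/-- The tensor product `t ⊗ δ`, whose symmetrization is `i_δ t`. -/
def mulDelta (t : Tensor ι m) : Tensor ι (m + 2) := fun i =>
  t (fun j => i (Fin.castAdd 2 j)) *
    if i (Fin.natAdd m 0) = i (Fin.natAdd m 1) then 1 else 0

theorem iDelta_eq_average_mulDelta (t : Tensor ι m) :
    t.iDelta = fun i => ((m + 2).factorial : ℂ)⁻¹ *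
      ∑ π : Equiv.Perm (Fin (m + 2)), t.mulDelta (i ∘ π) :=
  rfl

theorem contract_mulDelta [Fintype ι] (t : Tensor ι m) (ζ : ι → ℂ) :
    t.mulDelta.contract ζ = t.contract ζ * ∑ a, ζ a ^ 2 := by
  rw [contract, ← (Fin.appendEquiv m 2).sum_comp, Fintype.sum_prod_type, contract,
    Finset.sum_mul_sum]
  refine Finset.sum_congr rfl fun i _ => ?_
  rw [← (finTwoArrowEquiv ι).symm.sum_comp, Fintype.sum_prod_type]
  simp [mulDelta, Fin.appendEquiv, Fin.prod_univ_add, sq, mul_assoc]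

theorem contract_iDelta [Fintype ι] (t : Tensor ι m) (ζ : ι → ℂ) :
    t.iDelta.contract ζ = t.contract ζ * ∑ a, ζ a ^ 2 := by
  have hfactorial : ((m + 2).factorial : ℂ) ≠ 0 := Nat.cast_ne_zero.2 (Nat.factorial_ne_zero _)
  rw [iDelta_eq_average_mulDelta, contract_const_mul, contract_finsetSum]
  simp only [contract_comp_perm, contract_mulDelta, Finset.sum_const, Finset.card_univ,
    Fintype.card_perm, Fintype.card_fin, nsmul_eq_mul]
  exact inv_mul_cancel_left₀ hfactorial _

theorem contract_iDeltaPow [Fintype ι] (t : Tensor ι m) (l : ℕ) (ζ : ι → ℂ) :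
    (t.iDeltaPow l).contract ζ = t.contract ζ * (∑ a, ζ a ^ 2) ^ l := by
  induction l with
  | zero => simp [iDeltaPow]
  | succ l ih => rw [pow_succ, ← mul_assoc, ← ih]; exact contract_iDelta _ _

theorem iDelta_isSymmetric (t : Tensor ι m) : t.iDelta.IsSymmetric := fun σ i => by
  simp only [iDelta_eq_average_mulDelta]
  exact congrArg _ (Equiv.sum_comp (Equiv.mulLeft σ) fun π => t.mulDelta (i ∘ π))

end MetricProduct

namespace IsSymmetric

variable {ι : Type} {m : ℕ}

theorem eq_of_ofFn_perm {t : Tensor ι m} (ht : t.IsSymmetric) {i j : Fin m → ι}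
    (h : (List.ofFn i).Perm (List.ofFn j)) : t i = t j := by
  obtain ⟨π, rfl⟩ := exists_perm_comp_eq_of_ofFn_perm h
  exact ht π j

theorem comp_cast {n : ℕ} (h : n = m) {t : Tensor ι n} (ht : t.IsSymmetric) :
    IsSymmetric fun i : Fin m → ι => t (i ∘ Fin.cast h) := by
  subst h
  exact ht

theorem sub {s t : Tensor ι m} (hs : s.IsSymmetric) (ht : t.IsSymmetric) :
    (s - t).IsSymmetric := fun π i => congrArg₂ (· - ·) (hs π i) (ht π i)

theorem cons {t : Tensor ι (m + 1)} (ht : t.IsSymmetric) (a : ι) :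
    IsSymmetric fun i => t (Fin.cons a i) := fun π i =>
  ht.eq_of_ofFn_perm <| by
    simpa only [List.ofFn_cons, List.perm_cons] using π.ofFn_comp_perm i

theorem iDeltaPow [DecidableEq ι] {t : Tensor ι m} (ht : t.IsSymmetric) (l : ℕ) :
    (t.iDeltaPow l).IsSymmetric := by
  cases l with
  | zero => exact ht
  | succ l => exact iDelta_isSymmetric _

end IsSymmetric

section Polarization

variable {ι : Type} [Fintype ι] {m : ℕ}

/-- The homogeneous polynomial `∑ t_{i₁⋯i_m} X_{i₁} ⋯ X_{i_m}` associated with a tensor. -/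
noncomputable def toMvPolynomial (t : Tensor ι m) : MvPolynomial ι ℂ :=
  ∑ i : Fin m → ι, MvPolynomial.C (t i) * ∏ j, MvPolynomial.X (i j)

theorem eval_toMvPolynomial (t : Tensor ι m) (ζ : ι → ℂ) :
    MvPolynomial.eval ζ t.toMvPolynomial = t.contract ζ := by
  simp [toMvPolynomial, contract, map_sum, map_prod]

theorem toMvPolynomial_eq_sum_monomial (t : Tensor ι m) :
    t.toMvPolynomial = ∑ i : Fin m → ι,
      MvPolynomial.monomial (∑ j, Finsupp.single (i j) 1) (t i) := by
  simp only [toMvPolynomial, MvPolynomial.monomial_sum_index, MvPolynomial.X]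

theorem IsSymmetric.eq_zero_of_toMvPolynomial_eq_zero {t : Tensor ι m} (ht : t.IsSymmetric)
    (h : t.toMvPolynomial = 0) : t = 0 := by
  classical
  funext i₀
  have hcoeff := congrArg (MvPolynomial.coeff (∑ j, Finsupp.single (i₀ j) 1)) h
  simp only [toMvPolynomial_eq_sum_monomial, MvPolynomial.coeff_sum, MvPolynomial.coeff_monomial,
    MvPolynomial.coeff_zero, ← Finset.sum_filter] at hcoeff
  rw [Finset.sum_congr rfl fun i hi => ht.eq_of_ofFn_perm
    (ofFn_perm_of_sum_single_eq (Finset.mem_filter.1 hi).2), Finset.sum_const, nsmul_eq_mul,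
    mul_eq_zero, Nat.cast_eq_zero] at hcoeff
  exact hcoeff.resolve_left (Finset.card_ne_zero_of_mem (a := i₀) (by simp))

theorem IsSymmetric.eq_zero_of_contract_eq_zero {t : Tensor ι m} (ht : t.IsSymmetric)
    {s : Set ℂ} (hs : s.Infinite) (h : ∀ ζ : ι → ℂ, (∀ a, ζ a ∈ s) → t.contract ζ = 0) :
    t = 0 :=
  ht.eq_zero_of_toMvPolynomial_eq_zero <|
    MvPolynomial.funext_set (fun _ => s) (fun _ => hs) fun ζ hζ => by
      rw [eval_toMvPolynomial, map_zero, h ζ fun a => hζ a (Set.mem_univ a)]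

theorem IsSymmetric.eq_zero_of_contract_sphere {d : ℕ} [NeZero d] {t : Tensor (Fin d) m}
    (ht : t.IsSymmetric)
    (h : ∀ θ : EuclideanSpace ℝ (Fin d), ‖θ‖ = 1 → t.contract (fun a => (θ a : ℂ)) = 0) :
    t = 0 := by
  refine ht.eq_zero_of_contract_eq_zero
    ((Set.Ioi_infinite (0 : ℝ)).image Complex.ofReal_injective.injOn) fun ζ hζ => ?_
  choose x hx hxζ using hζ
  let y : EuclideanSpace ℝ (Fin d) := WithLp.toLp 2 x
  have hy : y ≠ 0 := fun h0 => (hx 0).ne' (congrArg (· 0) h0)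
  have hζy : ζ = (‖y‖ : ℂ) • fun a => (((‖y‖⁻¹ • y) a : ℝ) : ℂ) := by
    funext a
    have : (‖y‖ : ℂ) ≠ 0 := by simpa using hy
    simp [y, ← hxζ a, this]
  rw [hζy, contract_smul, h (‖y‖⁻¹ • y) (norm_smul_inv_norm hy), mul_zero]

end Polarization

end Tensor

open Finset.HasAntidiagonal (antidiagonal mem_antidiagonal)

theorem ofFn_padIndex {d p m : ℕ} (h : p ≤ m) (i : Fin p → Fin d) :
    List.ofFn (padIndex m i) = (List.ofFn i).map Fin.succ ++ List.replicate (m - p) 0 := by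
  obtain ⟨c, rfl⟩ := Nat.exists_eq_add_of_le h
  have : padIndex (p + c) i = Fin.append (Fin.succ ∘ i) fun _ => 0 := by
    funext j
    refine Fin.addCases (fun j => ?_) (fun j => ?_) j <;> simp [padIndex]
  rw [this, List.ofFn_fin_append, List.ofFn_const, List.map_ofFn, Nat.add_sub_cancel_left]

theorem padIndex_cons {d p m : ℕ} (a : Fin d) (i : Fin p → Fin d) :
    padIndex (m + 1) (Fin.cons a i : Fin (p + 1) → Fin d) = Fin.cons a.succ (padIndex m i) := by
  funext j
  refine Fin.cases ?_ (fun j => ?_) j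
  · simp [padIndex]
  · by_cases h : (j : ℕ) < p <;> simp [padIndex, h, ← Fin.succ_mk]

theorem ofFn_cons_padIndex_perm {d p m : ℕ} (h : p ≤ m) (i : Fin p → Fin d) :
    (List.ofFn (Fin.cons 0 (padIndex m i) : Fin (m + 1) → Fin (d + 1))).Perm
      (List.ofFn (padIndex (m + 1) i)) := by
  rw [List.ofFn_cons, ofFn_padIndex h, ofFn_padIndex (h.trans m.le_succ), Nat.succ_sub h,
    List.replicate_succ]
  exact List.perm_middle.symm

namespace Tensor

section Slices

variable {d m : ℕ} {T : Tensor (Fin (d + 1)) m}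

theorem IsSymmetric.tilde (hT : T.IsSymmetric) (q : ℕ) : (T.tilde q).IsSymmetric := by
  intro π i
  by_cases h : q ≤ m
  · refine congrArg (_ * ·) (hT.eq_of_ofFn_perm ?_)
    rw [ofFn_padIndex h, ofFn_padIndex h]
    exact ((π.ofFn_comp_perm i).map _).append_right _
  · simp [Tensor.tilde, Nat.choose_eq_zero_of_lt (not_le.1 h)]

theorem IsSymmetric.alternatingSum (hT : T.IsSymmetric) (p : ℕ) :
    (T.alternatingSum p).IsSymmetric := fun π i =>
  Finset.sum_congr rfl fun j _ =>
    congrArg _ (IsSymmetric.comp_cast (by omega) ((hT.tilde _).iDeltaPow j) π i)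

theorem IsSymmetric.contract_cons_eq_sum_choose (hT : T.IsSymmetric) (x₀ : ℂ) (x : Fin d → ℂ) :
    T.contract (Fin.cons x₀ x) = ∑ ij ∈ antidiagonal m, (m.choose ij.1 : ℂ) *
      (x₀ ^ ij.1 * contract (fun i : Fin ij.2 → Fin d => T (padIndex m i)) x) := by
  induction m with
  | zero =>
    rw [contract_zero_order T _ (padIndex 0 Fin.elim0)]
    simp [contract_zero_order _ _ Fin.elim0]
  | succ m ih =>
    have first_index_zero : x₀ * contract (fun i => T (Fin.cons 0 i)) (Fin.cons x₀ x) =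
        ∑ ij ∈ antidiagonal m, (m.choose ij.2 : ℂ) * (x₀ ^ (ij.1 + 1) *
          contract (fun i : Fin ij.2 → Fin d => T (padIndex (m + 1) i)) x) := by
      rw [ih (hT.cons 0), Finset.mul_sum]
      refine Finset.sum_congr rfl fun ij hij => ?_
      have hsum := mem_antidiagonal.1 hij
      have hslice (i : Fin ij.2 → Fin d) :
          T (Fin.cons 0 (padIndex m i)) = T (padIndex (m + 1) i) :=
        hT.eq_of_ofFn_perm (ofFn_cons_padIndex_perm (by omega) i)
      simp only [hslice, Nat.choose_symm_of_eq_add hsum.symm, pow_succ]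
      ring
    have first_index_succ :
        ∑ a, x a * contract (fun i => T (Fin.cons (Fin.succ a) i)) (Fin.cons x₀ x) =
          ∑ ij ∈ antidiagonal m, (m.choose ij.1 : ℂ) * (x₀ ^ ij.1 *
            contract (fun i : Fin (ij.2 + 1) → Fin d => T (padIndex (m + 1) i)) x) := by
      simp only [ih (hT.cons _), contract_succ, padIndex_cons, Finset.mul_sum]
      rw [Finset.sum_comm]
      exact Finset.sum_congr rfl fun _ _ => Finset.sum_congr rfl fun _ _ => by ring
    rw [contract_succ, Fin.sum_univ_succ]
    simp only [Fin.cons_zero, Fin.cons_succ]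
    rw [first_index_zero, first_index_succ, add_comm,
      Finset.sum_antidiagonal_choose_succ_mul fun j q => x₀ ^ j *
        contract (fun i : Fin q → Fin d => T (padIndex (m + 1) i)) x]

theorem IsSymmetric.contract_cons (hT : T.IsSymmetric) (x₀ : ℂ) (x : Fin d → ℂ) :
    T.contract (Fin.cons x₀ x) =
      ∑ ij ∈ antidiagonal m, x₀ ^ ij.1 * (T.tilde ij.2).contract x := by
  rw [hT.contract_cons_eq_sum_choose]
  refine Finset.sum_congr rfl fun ij hij => ?_
  have hsum := mem_antidiagonal.1 hij
  unfold Tensor.tilde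
  rw [contract_const_mul, Nat.choose_symm_of_eq_add (hsum.symm.trans (add_comm _ _))]
  ring

theorem contract_alternatingSum (T : Tensor (Fin (d + 1)) m) (p : ℕ) (x : Fin d → ℂ) :
    (T.alternatingSum p).contract x = ∑ j ∈ Finset.range (p / 2 + 1),
      (-1) ^ j * ((T.tilde (p - 2 * j)).contract x * (∑ a, x a ^ 2) ^ j) := by
  rw [← Fin.sum_univ_eq_sum_range fun j =>
    (-1) ^ j * ((T.tilde (p - 2 * j)).contract x * (∑ a, x a ^ 2) ^ j)]
  unfold Tensor.alternatingSum
  rw [contract_finsetSum]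
  refine Finset.sum_congr rfl fun j _ => ?_
  rw [contract_const_mul, contract_comp_cast, contract_iDeltaPow]

theorem contract_tilde_zero (T : Tensor (Fin (d + 1)) m) (x : Fin d → ℂ) :
    (T.tilde 0).contract x = (T.alternatingSum 0).contract x := by
  simp [contract_alternatingSum]

theorem contract_tilde_one (T : Tensor (Fin (d + 1)) m) (x : Fin d → ℂ) :
    (T.tilde 1).contract x = (T.alternatingSum 1).contract x := by
  simp [contract_alternatingSum]

theorem contract_tilde_add_two (T : Tensor (Fin (d + 1)) m) (p : ℕ) (x : Fin d → ℂ) :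
    (T.tilde (p + 2)).contract x =
      (T.alternatingSum (p + 2)).contract x + (∑ a, x a ^ 2) * (T.alternatingSum p).contract x := by
  simp only [contract_alternatingSum, Finset.mul_sum, Nat.add_div_right p two_pos]
  rw [Finset.sum_range_succ', add_right_comm, ← Finset.sum_add_distrib,
    Finset.sum_eq_zero fun j _ => ?_]
  · simp
  · rw [show p + 2 - 2 * (j + 1) = p - 2 * j by omega]
    ring

end Slices

end Tensor

theorem sum_antidiagonal_add_two_eq {R : Type*} [CommRing R] {τ A : ℕ → R} {ρ : R} (x₀ : R)
    (h₀ : τ 0 = A 0) (h₁ : τ 1 = A 1) (h : ∀ p, τ (p + 2) = A (p + 2) + ρ * A p) (k : ℕ) :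
    ∑ ij ∈ antidiagonal (k + 2), x₀ ^ ij.1 * τ ij.2 =
      (x₀ ^ 2 + ρ) * ∑ ij ∈ antidiagonal k, x₀ ^ ij.1 * A ij.2 +
        x₀ * A (k + 1) + A (k + 2) := by
  induction k with
  | zero =>
    simp only [Finset.Nat.sum_antidiagonal_succ, Finset.Nat.antidiagonal_zero, Finset.sum_singleton,
      h₀, h₁, h, pow_zero, one_mul]
    ring
  | succ k ih =>
    rw [Finset.Nat.sum_antidiagonal_succ, Finset.Nat.sum_antidiagonal_succ (n := k)]
    simp only [pow_succ', mul_assoc, ← Finset.mul_sum, ih, h (k + 1)]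
    ring

namespace Tensor

section Isotropic

variable {d m : ℕ}

theorem IsSymmetric.contract_cons_of_isotropic {T : Tensor (Fin (d + 1)) (m + 1)}
    (hT : T.IsSymmetric) {x₀ : ℂ} {x : Fin d → ℂ} (hx : x₀ ^ 2 + ∑ a, x a ^ 2 = 0) :
    T.contract (Fin.cons x₀ x) =
      x₀ * (T.alternatingSum m).contract x + (T.alternatingSum (m + 1)).contract x := by
  rw [hT.contract_cons]
  cases m with
  | zero =>
    simp [Finset.Nat.sum_antidiagonal_succ, contract_tilde_zero, contract_tilde_one, add_comm]
  | succ k =>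
    rw [sum_antidiagonal_add_two_eq (τ := fun q => (T.tilde q).contract x)
      (A := fun q => (T.alternatingSum q).contract x) x₀
      (T.contract_tilde_zero x) (T.contract_tilde_one x) (fun p => T.contract_tilde_add_two p x),
      hx, zero_mul, zero_add]

theorem complexDirection_eq_cons_smul (θ : EuclideanSpace ℝ (Fin d)) :
    complexDirection θ = Fin.cons 1 (Complex.I • fun a => (θ a : ℂ)) :=
  rfl

/-- The vectors `e₁ + i θ` with `θ` a unit vector of `ℝ^d` form the set of directions on which
the ray transform tests a tensor; this is the statement that `T` vanishes on all of them. -/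
def VanishesOnComplexDirections (T : Tensor (Fin (d + 1)) m) : Prop :=
  ∀ θ : EuclideanSpace ℝ (Fin d), ‖θ‖ = 1 → T.contract (complexDirection θ) = 0

theorem VanishesOnComplexDirections.alternatingSum_eq_zero [NeZero d]
    {T : Tensor (Fin (d + 1)) (m + 1)} (hT : T.IsSymmetric) (h : T.VanishesOnComplexDirections) :
    T.alternatingSum m = 0 ∧ T.alternatingSum (m + 1) = 0 := by
  let A (p : ℕ) (θ : EuclideanSpace ℝ (Fin d)) : ℂ :=
    (T.alternatingSum p).contract fun a => (θ a : ℂ)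
  have A_neg (p : ℕ) (θ : EuclideanSpace ℝ (Fin d)) : A p (-θ) = (-1) ^ p * A p θ := by
    rw [← contract_smul]
    exact congrArg (contract _) (by ext a; simp)
  have relation {θ : EuclideanSpace ℝ (Fin d)} (hθ : ‖θ‖ = 1) :
      A m θ + Complex.I * A (m + 1) θ = 0 := by
    have hsq : ∑ a, (θ a : ℂ) ^ 2 = 1 := by
      exact_mod_cast (EuclideanSpace.real_norm_sq_eq θ).symm.trans (by rw [hθ, one_pow])
    have hiso : (1 : ℂ) ^ 2 + ∑ a, (Complex.I • fun a => (θ a : ℂ)) a ^ 2 = 0 := by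
      simp [mul_pow, hsq]
    have hcontract := hT.contract_cons_of_isotropic hiso
    rw [contract_smul, contract_smul, ← complexDirection_eq_cons_smul, h θ hθ] at hcontract
    refine (mul_eq_zero.1 ?_).resolve_left (pow_ne_zero m Complex.I_ne_zero)
    linear_combination -hcontract
  have vanish {θ : EuclideanSpace ℝ (Fin d)} (hθ : ‖θ‖ = 1) : A m θ = 0 ∧ A (m + 1) θ = 0 := by
    have hneg := relation ((norm_neg θ).trans hθ)
    rw [A_neg, A_neg, pow_succ] at hneg
    have hsub : A m θ - Complex.I * A (m + 1) θ = 0 :=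
      (mul_eq_zero.1 (by linear_combination hneg)).resolve_left
        (pow_ne_zero m (neg_ne_zero.2 one_ne_zero))
    refine ⟨by linear_combination (relation hθ + hsub) / 2, ?_⟩
    refine (mul_eq_zero.1 ?_).resolve_left Complex.I_ne_zero
    linear_combination (relation hθ - hsub) / 2
  exact ⟨(hT.alternatingSum m).eq_zero_of_contract_sphere fun θ hθ => (vanish hθ).1,
    (hT.alternatingSum (m + 1)).eq_zero_of_contract_sphere fun θ hθ => (vanish hθ).2⟩

end Isotropic

section Assemble

variable {d : ℕ} {A : (p : ℕ) → Tensor (Fin d) p}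

/-- The value of a family of tensors of all orders at the multi-index given by a list. -/
def evalList (A : (p : ℕ) → Tensor (Fin d) p) (l : List (Fin d)) : ℂ :=
  A l.length l.get

theorem evalList_ofFn {p : ℕ} (i : Fin p → Fin d) : evalList A (List.ofFn i) = A p i := by
  have apply_cast {q : ℕ} (h : q = p) : A q (i ∘ Fin.cast h) = A p i := by
    subst h
    rfl
  rw [← apply_cast List.length_ofFn]
  exact congrArg (A _) (funext fun j => List.get_ofFn i j)

theorem evalList_perm (hA : ∀ p, (A p).IsSymmetric) {l l' : List (Fin d)} (h : l.Perm l') :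
    evalList A l = evalList A l' := by
  obtain ⟨i, rfl⟩ : ∃ i : Fin l'.length → Fin d, List.ofFn i = l :=
    ⟨fun j => l.get (j.cast h.length_eq.symm), by
      rw [← List.ofFn_congr h.length_eq, List.ofFn_get]⟩
  rw [evalList_ofFn]
  exact (hA _).eq_of_ofFn_perm (by rwa [List.ofFn_get])

/-- The coordinates in `ℝ^d` of a multi-index of `ℝ × ℝ^d`, with the occurrences of the first
coordinate deleted. -/
def tailIndices {k : ℕ} (i : Fin k → Fin (d + 1)) : List (Fin d) :=
  (List.ofFn i).filterMap (Fin.cases none some)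

theorem tailIndices_padIndex {p k : ℕ} (h : p ≤ k) (i : Fin p → Fin d) :
    tailIndices (padIndex k i) = List.ofFn i := by
  rw [tailIndices, ofFn_padIndex h, List.filterMap_append, List.filterMap_map]
  simp [Function.comp_def, List.filterMap_replicate]

/-- The symmetric tensor `v` of order `k` on `ℝ × ℝ^d` with the slices `ṽ^p = A p`. -/
noncomputable def assemble (A : (p : ℕ) → Tensor (Fin d) p) (k : ℕ) : Tensor (Fin (d + 1)) k :=
  fun i => (k.choose (k - (tailIndices i).length) : ℂ)⁻¹ * evalList A (tailIndices i)

theorem assemble_padIndex {p k : ℕ} (h : p ≤ k) (i : Fin p → Fin d) :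
    assemble A k (padIndex k i) = (k.choose (k - p) : ℂ)⁻¹ * A p i := by
  rw [assemble, tailIndices_padIndex h, List.length_ofFn, evalList_ofFn]

theorem assemble_isSymmetric (hA : ∀ p, (A p).IsSymmetric) (k : ℕ) :
    (assemble A k).IsSymmetric := fun π i => by
  have hperm : (tailIndices (i ∘ π)).Perm (tailIndices i) := (π.ofFn_comp_perm i).filterMap _
  rw [assemble, assemble, hperm.length_eq, evalList_perm hA hperm]

theorem tilde_assemble {q k : ℕ} (h : q ≤ k) : (assemble A k).tilde q = A q := by
  funext i
  rw [tilde, assemble_padIndex h, Nat.choose_symm h]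
  exact mul_inv_cancel_left₀ (Nat.cast_ne_zero.2 (Nat.choose_pos h).ne') _

end Assemble

section Isotropic

variable {d : ℕ} [NeZero d]

theorem IsSymmetric.eq_iDelta_assemble {k : ℕ} {T : Tensor (Fin (d + 1)) (k + 2)}
    (hT : T.IsSymmetric) (h : T.VanishesOnComplexDirections) :
    T = (assemble T.alternatingSum k).iDelta := by
  have hV := assemble_isSymmetric hT.alternatingSum k
  obtain ⟨hA₁, hA₂⟩ := h.alternatingSum_eq_zero hT
  refine sub_eq_zero.1 <| (hT.sub (iDelta_isSymmetric _)).eq_zero_of_contract_eq_zero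
    Set.infinite_univ fun ζ _ => ?_
  obtain ⟨x₀, x, rfl⟩ : ∃ x₀ x, ζ = Fin.cons x₀ x := ⟨ζ 0, Fin.tail ζ, (Fin.cons_self_tail ζ).symm⟩
  have tilde_eq : ∀ ij ∈ antidiagonal k, x₀ ^ ij.1 * (T.alternatingSum ij.2).contract x =
      x₀ ^ ij.1 * ((assemble T.alternatingSum k).tilde ij.2).contract x := fun ij hij => by
    rw [tilde_assemble (antidiagonal.snd_le hij)]
  rw [contract_sub, contract_iDelta, hT.contract_cons, hV.contract_cons,
    ← Finset.sum_congr rfl tilde_eq,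
    sum_antidiagonal_add_two_eq (τ := fun q => (T.tilde q).contract x)
      (A := fun q => (T.alternatingSum q).contract x) x₀ (T.contract_tilde_zero x)
      (T.contract_tilde_one x) (fun p => T.contract_tilde_add_two p x), hA₁, hA₂]
  simp [Fin.sum_univ_succ, mul_comm]

theorem IsSymmetric.eq_zero_of_vanishesOnComplexDirections {m : ℕ} (hm : m ≤ 1)
    {T : Tensor (Fin (d + 1)) m} (hT : T.IsSymmetric) (h : T.VanishesOnComplexDirections) :
    T = 0 := by
  refine hT.eq_zero_of_contract_eq_zero Set.infinite_univ fun ζ _ => ?_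
  interval_cases m
  · have hunit : ‖EuclideanSpace.single (0 : Fin d) (1 : ℝ)‖ = 1 := by simp
    rw [contract_zero_order T ζ Fin.elim0, ← contract_zero_order T _ Fin.elim0, h _ hunit]
  · obtain ⟨hA₀, hA₁⟩ := h.alternatingSum_eq_zero hT
    obtain ⟨x₀, x, rfl⟩ : ∃ x₀ x, ζ = Fin.cons x₀ x :=
      ⟨ζ 0, Fin.tail ζ, (Fin.cons_self_tail ζ).symm⟩
    rw [hT.contract_cons]
    simp [Finset.Nat.sum_antidiagonal_succ, contract_tilde_zero, contract_tilde_one, hA₀, hA₁]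

end Isotropic

end Tensor

section Fourier

open scoped FourierTransform

variable {E : Type*} [NormedAddCommGroup E] [InnerProductSpace ℝ E] [FiniteDimensional ℝ E]
  [MeasurableSpace E] [BorelSpace E]

theorem ae_eq_zero_of_fourier_eq_zero {V : Type*} [NormedAddCommGroup V] [NormedSpace ℂ V]
    [CompleteSpace V] {F : E → V} (hF : Integrable F) (h : 𝓕 F = 0) : F =ᵐ[volume] 0 := by
  refine ae_eq_zero_of_integral_contDiff_smul_eq_zero hF.locallyIntegrable fun g hg hg_supp => ?_
  have hg_supp' : HasCompactSupport (Complex.ofRealCLM ∘ g) := hg_supp.comp_left rfl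
  let G : SchwartzMap E ℂ := hg_supp'.toSchwartzMap (Complex.ofRealCLM.contDiff.comp hg)
  let H : SchwartzMap E ℂ := 𝓕⁻ G
  have hH : 𝓕 (H : E → ℂ) = G := by
    rw [← SchwartzMap.fourier_coe]
    simp [H]
  calc ∫ x, g x • F x = ∫ x, 𝓕 (H : E → ℂ) x • F x := by
        rw [hH]
        rfl
    _ = ∫ x, H x • 𝓕 F x := by
        have := VectorFourier.integral_fourierIntegral_smul_eq_flip (L := innerₗ E)
          Real.continuous_fourierChar continuous_inner (H.integrable (μ := volume)) hF
        rwa [flip_innerₗ] at this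
    _ = 0 := by simp [h]

end Fourier

section Moments

theorem integrable_continuous_mul_of_support_subset {μ : Measure ℝ} {h φ : ℝ → ℂ} {L : ℝ}
    (hφ : Continuous φ) (hh : Integrable h μ) (hsupp : Function.support h ⊆ Set.Icc (-L) L) :
    Integrable (fun r => φ r * h r) μ :=
  (integrableOn_iff_integrable_of_support_subset <|
    (Function.support_mul_subset_right _ _).trans hsupp).1 <|
      hh.integrableOn.continuousOn_mul hφ.continuousOn isCompact_Icc

theorem norm_integral_exp_mul_le_of_moments_eq_zero {μ : Measure ℝ} {h : ℝ → ℂ} {L : ℝ} {m : ℕ}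
    (hh : Integrable h μ) (hsupp : Function.support h ⊆ Set.Icc (-L) L)
    (hmom : ∀ α ≤ m, ∫ r, (r : ℂ) ^ α * h r ∂μ = 0) (z : ℂ) :
    ‖∫ r, Complex.exp (r * z) * h r ∂μ‖ ≤
      (L * ‖z‖) ^ (m + 1) * Real.exp (L * ‖z‖) * ∫ r, ‖h r‖ ∂μ := by
  let taylor (r : ℝ) : ℂ := ∑ α ∈ Finset.range (m + 1), (r * z) ^ α / α.factorial
  have taylor_cont : Continuous taylor := by fun_prop
  have integral_taylor : ∫ r, taylor r * h r ∂μ = 0 := by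
    simp only [taylor, Finset.sum_mul]
    rw [integral_finsetSum _ fun α _ =>
      integrable_continuous_mul_of_support_subset (by fun_prop) hh hsupp]
    refine Finset.sum_eq_zero fun α hα => ?_
    calc ∫ r : ℝ, (r * z) ^ α / α.factorial * h r ∂μ
        = ∫ r : ℝ, z ^ α / α.factorial * ((r : ℂ) ^ α * h r) ∂μ := by
          congr with r
          ring
      _ = 0 := by rw [integral_const_mul, hmom α (Finset.mem_range_succ_iff.1 hα), mul_zero]
  have remainder_le (r : ℝ) : ‖Complex.exp (r * z) * h r - taylor r * h r‖ ≤
      (L * ‖z‖) ^ (m + 1) * Real.exp (L * ‖z‖) * ‖h r‖ := by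
    rw [← sub_mul, norm_mul]
    by_cases hr : h r = 0
    · simp [hr]
    · have hrL : ‖(r : ℂ) * z‖ ≤ L * ‖z‖ := by
        rw [norm_mul, Complex.norm_real]
        exact mul_le_mul_of_nonneg_right (abs_le.2 (hsupp hr)) (norm_nonneg z)
      calc _ ≤ ‖r * z‖ ^ (m + 1) * Real.exp ‖r * z‖ * ‖h r‖ := by
            gcongr
            exact Complex.norm_exp_sub_sum_le_norm_mul_exp _ _
        _ ≤ _ := by
            have := (norm_nonneg _).trans hrL
            gcongr
  have exp_integrable := integrable_continuous_mul_of_support_subset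
    (φ := fun r => Complex.exp (r * z)) (by fun_prop) hh hsupp
  calc ‖∫ r, Complex.exp (r * z) * h r ∂μ‖
      = ‖∫ r, (Complex.exp (r * z) * h r - taylor r * h r) ∂μ‖ := by
        rw [integral_sub exp_integrable
          (integrable_continuous_mul_of_support_subset taylor_cont hh hsupp), integral_taylor,
          sub_zero]
    _ ≤ _ := by
        rw [← integral_const_mul]
        exact norm_integral_le_of_norm_le (hh.norm.const_mul _) (.of_forall remainder_le)

end Moments

section Slab

open scoped FourierTransform ENNReal

variable {E : Type*} [NormedAddCommGroup E] [InnerProductSpace ℝ E] {θ : E}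

/-- The slab `a ≤ ⟨y, θ⟩ < a + 1`, which for a unit vector `θ` meets every line with direction `θ`
in a segment of length one. -/
def slab (θ : E) (a : ℝ) : Set E :=
  {y | inner ℝ y θ ∈ Set.Ico a (a + 1)}

theorem sub_smul_mem_slab_iff (hθ : ‖θ‖ = 1) {a : ℝ} {x : E} {r : ℝ} :
    x - r • θ ∈ slab θ a ↔ r ∈ Set.Ioc (inner ℝ x θ - (a + 1)) (inner ℝ x θ - a) := by
  simp only [slab, Set.mem_ofPred_eq, inner_sub_left, inner_smul_left,
    real_inner_self_eq_norm_sq, hθ]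
  simp only [conj_trivial, one_pow, mul_one, Set.mem_Ico, Set.mem_Ioc]
  constructor <;> rintro ⟨h₁, h₂⟩ <;> constructor <;> linarith

theorem lt_norm_of_mem_slab (hθ : ‖θ‖ = 1) {R : ℝ} {y : E} (hy : y ∈ slab θ (-(R + 1))) :
    R < ‖y‖ := by
  have := neg_le_of_abs_le (abs_real_inner_le_norm y θ)
  rw [hθ] at this
  linarith [hy.2]

theorem mem_Ioc_of_norm_add_smul_le (hθ : ‖θ‖ = 1) {R r : ℝ} {y : E}
    (hy : y ∈ slab θ (-(R + 1))) (hr : ‖y + r • θ‖ ≤ R) : r ∈ Set.Ioc 0 (2 * R + 1) := by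
  have hinner : |inner ℝ y θ + r| ≤ R := by
    have := abs_real_inner_le_norm (y + r • θ) θ
    simp only [inner_add_left, inner_smul_left, real_inner_self_eq_norm_sq, hθ] at this
    exact (by simpa using this : _ ≤ ‖y + r • θ‖).trans hr
  obtain ⟨h₁, h₂⟩ := abs_le.1 hinner
  constructor <;> linarith [hy.1, hy.2]

theorem norm_integral_fourierChar_smul_line_le {g : E → ℂ} {R : ℝ} {m : ℕ} {y : E}
    (hθ : ‖θ‖ = 1) (hsupp : ∀ x, R < ‖x‖ → g x = 0) (hy : y ∈ slab θ (-(R + 1)))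
    (hg : Integrable fun r : ℝ => g (y + r • θ))
    (hmom : ∀ α ≤ m, ∫ r in Set.Ioi (0 : ℝ), (r : ℂ) ^ α * g (y + r • θ) = 0) (ξ : E) :
    ‖∫ r : ℝ, 𝐞 (-inner ℝ (y + r • θ) ξ) • g (y + r • θ)‖ ≤
      ((2 * R + 1) * (2 * Real.pi * |inner ℝ θ ξ|)) ^ (m + 1) *
        Real.exp ((2 * R + 1) * (2 * Real.pi * |inner ℝ θ ξ|)) * ∫ r : ℝ, ‖g (y + r • θ)‖ := by
  let z : ℂ := ↑(2 * Real.pi * -inner ℝ θ ξ) * Complex.I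
  have norm_z : ‖z‖ = 2 * Real.pi * |inner ℝ θ ξ| := by
    simp [z, abs_of_pos Real.pi_pos]
  have char_eq (r : ℝ) : (𝐞 (-inner ℝ (y + r • θ) ξ) : ℂ) =
      𝐞 (-inner ℝ y ξ) * Complex.exp (r * z) := by
    simp only [Real.fourierChar_apply, z, ← Complex.exp_add, inner_add_left, inner_smul_left]
    congr 1
    simp only [Real.ringHom_apply, neg_add_rev, Complex.ofReal_mul, Complex.ofReal_ofNat,
      Complex.ofReal_add, Complex.ofReal_neg, mul_neg, neg_mul]
    ring
  have supp_line (r : ℝ) (hr : g (y + r • θ) ≠ 0) : r ∈ Set.Ioc 0 (2 * R + 1) :=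
    mem_Ioc_of_norm_add_smul_le hθ hy (not_lt.1 fun h => hr (hsupp _ h))
  rw [← norm_z]
  simp only [Circle.smul_def, char_eq, smul_eq_mul, mul_assoc (𝐞 _ : ℂ)]
  rw [integral_const_mul, norm_mul, Circle.norm_coe, one_mul]
  refine norm_integral_exp_mul_le_of_moments_eq_zero hg (fun r hr => ?_) (fun α hα => ?_) z
  · exact ⟨by linarith [(supp_line r hr).1, (supp_line r hr).2], (supp_line r hr).2⟩
  · rw [← hmom α hα, setIntegral_eq_integral_of_forall_compl_eq_zero]
    exact fun r hr => mul_eq_zero_of_right _ (not_not.1 fun h => hr (supp_line r h).1)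

variable [FiniteDimensional ℝ E] [MeasurableSpace E] [BorelSpace E]

theorem measurableSet_slab (θ : E) (a : ℝ) : MeasurableSet (slab θ a) :=
  measurableSet_Ico.preimage (by fun_prop)

theorem measurePreserving_slab_add_smul (hθ : ‖θ‖ = 1) (a : ℝ) :
    MeasurePreserving (fun p : E × ℝ => p.1 + p.2 • θ)
      ((volume.restrict (slab θ a)).prod volume) volume := by
  classical
  have hslab := measurableSet_slab θ a
  let w : E → ℝ≥0∞ := (slab θ a).indicator 1
  have hw : Measurable w := measurable_one.indicator hslab
  have line_length (x : E) : ∫⁻ r : ℝ, w (x - r • θ) = 1 := by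
    calc ∫⁻ r : ℝ, w (x - r • θ)
        = ∫⁻ r, (Set.Ioc (inner ℝ x θ - (a + 1)) (inner ℝ x θ - a)).indicator 1 r := by
          simp only [w, Set.indicator_apply, sub_smul_mem_slab_iff hθ, Pi.one_apply]
      _ = 1 := by
          rw [lintegral_indicator_one measurableSet_Ioc, Real.volume_Ioc]
          norm_num
  refine ⟨by fun_prop, Measure.ext_of_lintegral _ fun g hg => ?_⟩
  calc ∫⁻ x, g x ∂((volume.restrict (slab θ a)).prod volume).map (fun p : E × ℝ => p.1 + p.2 • θ)
      = ∫⁻ r : ℝ, ∫⁻ y in slab θ a, g (y + r • θ) := by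
        rw [lintegral_map hg (by fun_prop), lintegral_prod_symm' _ (by fun_prop)]
    _ = ∫⁻ r : ℝ, ∫⁻ y, w y * g (y + r • θ) := by
        congr with r
        rw [← lintegral_indicator hslab]
        congr with y
        simp [w, Set.indicator_apply]
    _ = ∫⁻ r : ℝ, ∫⁻ x, w (x - r • θ) * g x := by
        congr with r
        rw [← lintegral_sub_right_eq_self _ (r • θ)]
        simp
    _ = ∫⁻ x, ∫⁻ r : ℝ, w (x - r • θ) * g x :=
        lintegral_lintegral_swap (Measurable.aemeasurable (by fun_prop))
    _ = ∫⁻ x, g x := by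
        congr with x
        rw [lintegral_mul_const _ (by fun_prop), line_length, one_mul]

theorem integral_slab_integral_line {V : Type*} [NormedAddCommGroup V] [NormedSpace ℝ V]
    (hθ : ‖θ‖ = 1) (a : ℝ) {F : E → V} (hF : Integrable F) :
    ∫ y in slab θ a, ∫ r : ℝ, F (y + r • θ) = ∫ x, F x := by
  have h := measurePreserving_slab_add_smul hθ a
  rw [integral_integral (f := fun y r => F (y + r • θ)) (h.integrable_comp_of_integrable hF),
    ← integral_map h.measurable.aemeasurable (h.map_eq.symm ▸ hF.aestronglyMeasurable), h.map_eq]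

theorem norm_fourier_le_of_moments_eq_zero {g : E → ℂ} {R : ℝ} {m : ℕ} (hθ : ‖θ‖ = 1)
    (hg : Integrable g) (hsupp : ∀ x, R < ‖x‖ → g x = 0)
    (hmom : ∀ᵐ y, R < ‖y‖ → ∀ α ≤ m, ∫ r in Set.Ioi (0 : ℝ), (r : ℂ) ^ α * g (y + r • θ) = 0)
    (ξ : E) :
    ‖𝓕 g ξ‖ ≤ ((2 * R + 1) * (2 * Real.pi * |inner ℝ θ ξ|)) ^ (m + 1) *
      Real.exp ((2 * R + 1) * (2 * Real.pi * |inner ℝ θ ξ|)) * ∫ x, ‖g x‖ := by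
  have line_integrable :
      Integrable (fun p : E × ℝ => g (p.1 + p.2 • θ))
        ((volume.restrict (slab θ (-(R + 1)))).prod volume) :=
    (measurePreserving_slab_add_smul hθ _).integrable_comp_of_integrable hg
  rw [Real.fourier_eq, ← integral_slab_integral_line hθ (-(R + 1))
    ((Real.fourierIntegral_convergent_iff ξ).2 hg),
    ← integral_slab_integral_line hθ (-(R + 1)) hg.norm, ← integral_const_mul]
  refine norm_integral_le_of_norm_le (line_integrable.norm.integral_prod_left.const_mul _) ?_
  filter_upwards [ae_restrict_mem (measurableSet_slab _ _), ae_restrict_of_ae hmom,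
    line_integrable.prod_right_ae] with y hy hmom_y hint_y
  exact norm_integral_fourierChar_smul_line_le hθ hsupp hy hint_y
    (hmom_y (lt_norm_of_mem_slab hθ hy)) ξ

end Slab

section AlmostEverywhere

theorem ae_ae_eq_zero_comm {X Y V : Type*} [MeasurableSpace X] [MeasurableSpace Y]
    [NormedAddCommGroup V] {μ : Measure X} {ν : Measure Y} [SFinite μ] [SFinite ν] {φ : X × Y → V}
    (hφ : AEStronglyMeasurable φ (μ.prod ν)) (h : ∀ᵐ x ∂μ, ∀ᵐ y ∂ν, φ (x, y) = 0) :
    ∀ᵐ y ∂ν, ∀ᵐ x ∂μ, φ (x, y) = 0 := by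
  have hmeas : MeasurableSet {z | hφ.mk φ z = 0} :=
    hφ.stronglyMeasurable_mk.measurableSet_eq_fun stronglyMeasurable_zero
  have hmk : ∀ᵐ z ∂μ.prod ν, hφ.mk φ z = 0 := by
    rw [Measure.ae_prod_iff_ae_ae hmeas]
    filter_upwards [h, Measure.ae_ae_of_ae_prod hφ.ae_eq_mk] with x hx hx'
    filter_upwards [hx, hx'] with y hy hy'
    rw [← hy', hy]
  have hzero : ∀ᵐ z ∂μ.prod ν, φ z = 0 := by
    filter_upwards [hφ.ae_eq_mk, hmk] with z hz hz'
    rw [hz, hz']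
  exact Measure.ae_ae_of_ae_prod (Measure.measurePreserving_swap.quasiMeasurePreserving.ae hzero)

theorem quasiMeasurePreserving_add_comp {G S T : Type*} [AddGroup G] [MeasurableSpace G]
    [MeasurableAdd₂ G] [MeasurableSpace S] [MeasurableSpace T] (μ : Measure G)
    [μ.IsAddRightInvariant] [SFinite μ] (σ : Measure S) [SFinite σ] (τ : Measure T) [SFinite τ]
    {g : S × T → G} (hg : Measurable g) :
    Measure.QuasiMeasurePreserving (fun z : (G × S) × T => z.1.1 + g (z.1.2, z.2))
      ((μ.prod σ).prod τ) μ := by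
  refine QuasiMeasurePreserving.prod_of_left (by fun_prop) (ae_of_all _ fun t => ?_)
  refine QuasiMeasurePreserving.prod_of_left (by fun_prop) (ae_of_all _ fun s => ?_)
  exact (measurePreserving_add_right μ (g (s, t))).quasiMeasurePreserving

theorem mem_of_ae_mem_of_continuousAt {X Y : Type*} [TopologicalSpace X] [MeasurableSpace X]
    [TopologicalSpace Y] {μ : Measure X} [μ.IsOpenPosMeasure] {F : X → Y} {C : Set Y}
    (hC : IsClosed C) (h : ∀ᵐ x ∂μ, F x ∈ C) {x : X} (hx : ContinuousAt F x) : F x ∈ C := by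
  rw [← hC.closure_eq]
  exact hx.continuousWithinAt.mem_closure (Measure.dense_of_ae h x) fun _ hy => hy

theorem forall_unit_of_ae_toSphere {E : Type*} [NormedAddCommGroup E] [NormedSpace ℝ E]
    [FiniteDimensional ℝ E] [MeasurableSpace E] [BorelSpace E] (μ : Measure E)
    [μ.IsOpenPosMeasure] {C : Set E} (hC : IsClosed C)
    (h : ∀ᵐ θ : Metric.sphere (0 : E) 1 ∂μ.toSphere, θ.1 ∈ C) {θ : E} (hθ : ‖θ‖ = 1) : θ ∈ C :=
  mem_of_ae_mem_of_continuousAt (x := ⟨θ, mem_sphere_zero_iff_norm.2 hθ⟩) hC h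
    continuous_subtype_val.continuousAt

end AlmostEverywhere

section VectorFourier

open scoped FourierTransform

variable {E V : Type*} [NormedAddCommGroup E] [InnerProductSpace ℝ E] [FiniteDimensional ℝ E]
  [MeasurableSpace E] [BorelSpace E] [NormedAddCommGroup V] [NormedSpace ℂ V] [CompleteSpace V]

theorem fourier_clm_comp {W : Type*} [NormedAddCommGroup W] [NormedSpace ℂ W] [CompleteSpace W]
    (L : V →L[ℂ] W) {F : E → V} (hF : Integrable F) (ξ : E) :
    𝓕 (fun x => L (F x)) ξ = L (𝓕 F ξ) := by
  have hint : Integrable fun x => Real.fourierChar (-inner ℝ x ξ) • F x :=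
    (Real.fourierIntegral_convergent_iff ξ).2 hF
  rw [Real.fourier_eq, Real.fourier_eq, ← L.integral_comp_comm hint]
  simp only [Circle.smul_def, map_smul]

theorem ae_mem_of_forall_fourier_mem {W : Submodule ℂ V} (hW : IsClosed (W : Set V))
    {F : E → V} (hF : Integrable F) (h : ∀ ξ, 𝓕 F ξ ∈ W) : ∀ᵐ x, F x ∈ W := by
  have hquot : 𝓕 (fun x => W.mkQL (F x)) = 0 := by
    ext ξ
    rw [fourier_clm_comp _ hF]
    exact (Submodule.Quotient.mk_eq_zero W).2 (h ξ)
  filter_upwards [ae_eq_zero_of_fourier_eq_zero (W.mkQL.integrable_comp hF) hquot] with x hx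
  exact (Submodule.Quotient.mk_eq_zero W).1 hx

end VectorFourier

section Stereographic

open scoped Polynomial RealInnerProductSpace
open Polynomial (X)

theorem exists_eq_C_mul_X_pow_of_norm_eval_le {P : ℂ[X]} {C : ℝ} {n : ℕ}
    (h : ∀ t : ℝ, ‖P.eval (t : ℂ)‖ ≤ C * |t| ^ n) : ∃ c, P = Polynomial.C c * X ^ n := by
  induction n generalizing P with
  | zero =>
    suffices P.degree ≤ 0 from ⟨_, by simpa using Polynomial.eq_C_of_degree_le_zero this⟩
    by_contra! hdeg
    have unbounded := P.tendsto_norm_atTop hdeg (z := fun t : ℝ => (t : ℂ))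
      (by simpa using Filter.tendsto_abs_atTop_atTop)
    obtain ⟨t, ht⟩ := (unbounded.eventually_gt_atTop C).exists
    exact absurd (h t) (by simpa using ht)
  | succ n ih =>
    obtain ⟨Q, rfl⟩ : X ∣ P := Polynomial.X_dvd_iff.2 <| by
      rw [Polynomial.coeff_zero_eq_eval_zero]
      simpa using h 0
    have bound_off_zero : ∀ t ∈ ({0}ᶜ : Set ℝ), ‖Q.eval (t : ℂ)‖ ≤ C * |t| ^ n := by
      intro t ht
      refine le_of_mul_le_mul_left ?_ (abs_pos.2 ht)
      calc |t| * ‖Q.eval (t : ℂ)‖ = ‖(X * Q).eval (t : ℂ)‖ := by simp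
        _ ≤ |t| * (C * |t| ^ n) := (h t).trans_eq (by ring)
    have bound_closed : IsClosed {t : ℝ | ‖Q.eval (t : ℂ)‖ ≤ C * |t| ^ n} :=
      isClosed_le (by fun_prop) (by fun_prop)
    obtain ⟨c, rfl⟩ := ih fun t =>
      bound_closed.closure_subset_iff.2 bound_off_zero (dense_compl_singleton 0 t)
    exact ⟨c, by ring⟩

theorem eq_zero_of_norm_eval_mul_le {P D : ℂ[X]} {z : ℂ} (hD : D ≠ 0) (hz : D.IsRoot z)
    (hz₀ : z ≠ 0) {C : ℝ} {n : ℕ} (h : ∀ t : ℝ, ‖(P * D).eval (t : ℂ)‖ ≤ C * |t| ^ n) : P = 0 := by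
  obtain ⟨c, hc⟩ := exists_eq_C_mul_X_pow_of_norm_eval_le h
  have hc₀ : c = 0 := by
    have := congrArg (Polynomial.eval z) hc
    simpa [hz.eq_zero, hz₀, eq_comm] using this
  rw [hc₀, map_zero, zero_mul] at hc
  exact (mul_eq_zero.1 hc).resolve_right hD

theorem exists_norm_eq_one_inner_eq_zero {E : Type*} [NormedAddCommGroup E]
    [InnerProductSpace ℝ E] (hE : 1 < Module.finrank ℝ E) (ξ : E) :
    ∃ p : E, ‖p‖ = 1 ∧ ⟪p, ξ⟫ = 0 := by
  have : FiniteDimensional ℝ E := .of_finrank_pos (by omega)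
  obtain ⟨q, hq, hq₀⟩ := Submodule.exists_mem_ne_zero_of_ne_bot <|
    LinearMap.ker_ne_bot_of_finrank_lt (f := innerₗ E ξ) (by simpa using hE)
  refine ⟨‖q‖⁻¹ • q, norm_smul_inv_norm (𝕜 := ℝ) hq₀, ?_⟩
  rw [inner_smul_left, real_inner_comm]
  simpa using Or.inr hq

theorem smul_complexDirection_inv_smul {d : ℕ} {c : ℝ} (hc : c ≠ 0)
    (x : EuclideanSpace ℝ (Fin d)) :
    (c : ℂ) • complexDirection (c⁻¹ • x) = Fin.cons (c : ℂ) fun j => Complex.I * (x j : ℂ) := by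
  refine funext fun a => Fin.cases (by simp [complexDirection]) (fun j => ?_) a
  have : (c : ℂ) ≠ 0 := Complex.ofReal_ne_zero.2 hc
  simp only [complexDirection, PiLp.smul_apply, smul_eq_mul, Complex.ofReal_mul,
    Complex.ofReal_inv, Pi.smul_apply, Fin.cons_succ]
  field_simp

variable {d m : ℕ}

theorem Tensor.exists_polynomial_eval_eq_contract {ι : Type} [Fintype ι] (T : Tensor ι m)
    (N : ι → ℂ[X]) : ∃ Q : ℂ[X], ∀ z, Q.eval z = T.contract fun a => (N a).eval z :=
  ⟨∑ i, Polynomial.C (T i) * ∏ j, N (i j), fun z => by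
    simp [contract, Polynomial.eval_finsetSum, Polynomial.eval_prod]⟩

theorem stereoInvFun_smul {E : Type*} [NormedAddCommGroup E] [InnerProductSpace ℝ E] {p : E}
    (hp : ‖p‖ = 1) (t : ℝ) (w : (ℝ ∙ p)ᗮ) :
    (stereoInvFun hp (t • w) : E) = (‖w‖ ^ 2 * t ^ 2 + 4)⁻¹ •
      ((4 * t) • (w : E) + (‖w‖ ^ 2 * t ^ 2 - 4) • p) := by
  rw [stereoInvFun_apply, norm_smul, mul_pow, Real.norm_eq_abs, sq_abs, mul_comm (t ^ 2),
    Submodule.coe_smul, smul_smul]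

theorem Tensor.exists_polynomial_contract_stereoInvFun (T : Tensor (Fin (d + 1)) m)
    {p : EuclideanSpace ℝ (Fin d)} (hp : ‖p‖ = 1) (w : (ℝ ∙ p)ᗮ) :
    ∃ Q : ℂ[X], ∀ t : ℝ, Q.eval (t : ℂ) = ((‖w‖ ^ 2 * t ^ 2 + 4 : ℝ) : ℂ) ^ m *
      T.contract (complexDirection (stereoInvFun hp (t • w)).1) := by
  let D : ℂ[X] := Polynomial.C (‖w‖ ^ 2 : ℂ) * X ^ 2
  obtain ⟨Q, hQ⟩ := T.exists_polynomial_eval_eq_contract <| Fin.cons (D + 4) fun j =>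
    Polynomial.C Complex.I *
      (4 * X * Polynomial.C (w.1 j : ℂ) + (D - 4) * Polynomial.C (p j : ℂ))
  refine ⟨Q, fun t => ?_⟩
  rw [hQ, ← Tensor.contract_smul, stereoInvFun_smul,
    smul_complexDirection_inv_smul (by positivity)]
  congr 1
  exact funext fun a => Fin.cases (by simp [D]) (fun j => by simp [D]) a

theorem Tensor.contract_complexDirection_stereoInvFun_eq_zero {T : Tensor (Fin (d + 1)) m}
    {ξ p : EuclideanSpace ℝ (Fin d)} {C : ℝ} (hp : ‖p‖ = 1) (hpξ : ⟪p, ξ⟫ = 0)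
    (h : ∀ θ : EuclideanSpace ℝ (Fin d), ‖θ‖ = 1 →
      ‖T.contract (complexDirection θ)‖ ≤ C * |⟪θ, ξ⟫| ^ (m + 1))
    {w : (ℝ ∙ p)ᗮ} (hw : w ≠ 0) : T.contract (complexDirection (stereoInvFun hp w).1) = 0 := by
  obtain ⟨Q, hQ⟩ := T.exists_polynomial_contract_stereoInvFun hp w
  let D : ℂ[X] := Polynomial.C (‖w‖ ^ 2 : ℂ) * X ^ 2 + 4
  have norm_w : (‖w‖ : ℂ) ≠ 0 := Complex.ofReal_ne_zero.2 (norm_ne_zero_iff.2 hw)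
  have hD : D ≠ 0 := fun h => by simpa [D] using congrArg (Polynomial.eval 0) h
  have root_D : D.IsRoot (2 * Complex.I / ‖w‖) := by
    simp only [D, Polynomial.IsRoot, Polynomial.eval_add, Polynomial.eval_mul, Polynomial.eval_C,
      Polynomial.eval_pow, Polynomial.eval_X, Polynomial.eval_ofNat]
    field_simp
    rw [Complex.I_sq]
    ring
  have bound (t : ℝ) : ‖(Q * D).eval (t : ℂ)‖ ≤
      C * |4 * ⟪(w : EuclideanSpace ℝ (Fin d)), ξ⟫| ^ (m + 1) * |t| ^ (m + 1) := by
    let ρ : ℝ := ‖w‖ ^ 2 * t ^ 2 + 4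
    have hρ : 0 < ρ := by positivity
    let θ : EuclideanSpace ℝ (Fin d) := stereoInvFun hp (t • w)
    have inner_θ : ρ * ⟪θ, ξ⟫ = 4 * ⟪(w : EuclideanSpace ℝ (Fin d)), ξ⟫ * t := by
      simp only [θ, stereoInvFun_smul, inner_smul_left, inner_add_left, hpξ, conj_trivial]
      field_simp
      ring
    have eval_D : D.eval (t : ℂ) = ρ := by simp [D, ρ]
    calc ‖(Q * D).eval (t : ℂ)‖ = ρ ^ (m + 1) * ‖T.contract (complexDirection θ)‖ := by
          rw [Polynomial.eval_mul, hQ, eval_D, norm_mul, norm_mul, norm_pow, Complex.norm_real,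
            Real.norm_of_nonneg hρ.le]
          ring
      _ ≤ ρ ^ (m + 1) * (C * |⟪θ, ξ⟫| ^ (m + 1)) := by
          gcongr
          exact h θ (norm_eq_of_mem_sphere _)
      _ = C * |ρ * ⟪θ, ξ⟫| ^ (m + 1) := by rw [abs_mul, abs_of_pos hρ, mul_pow]; ring
      _ = _ := by rw [inner_θ, abs_mul _ t, mul_pow, mul_assoc]
  have hQ₀ : Q = 0 := eq_zero_of_norm_eval_mul_le hD root_D (div_ne_zero (by simp) norm_w) bound
  have := hQ 1
  rw [hQ₀, Polynomial.eval_zero, one_smul, eq_comm, mul_eq_zero] at this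
  exact this.resolve_left (pow_ne_zero m (Complex.ofReal_ne_zero.2 (by positivity)))

theorem Tensor.vanishesOnComplexDirections_of_norm_contract_le (hd : 2 ≤ d)
    {T : Tensor (Fin (d + 1)) m} {ξ : EuclideanSpace ℝ (Fin d)} {C : ℝ}
    (h : ∀ θ : EuclideanSpace ℝ (Fin d), ‖θ‖ = 1 →
      ‖T.contract (complexDirection θ)‖ ≤ C * |⟪θ, ξ⟫| ^ (m + 1)) :
    VanishesOnComplexDirections T := by
  obtain ⟨p, hp, hpξ⟩ := exists_norm_eq_one_inner_eq_zero (by simpa using Nat.lt_of_succ_le hd) ξ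
  intro θ hθ
  by_cases hθξ : ⟪θ, ξ⟫ = 0
  · simpa [hθξ] using h θ hθ
  have hθp : θ ≠ p := fun h => hθξ (h ▸ hpξ)
  have hstereo : (stereoInvFun hp (stereoToFun p θ) : EuclideanSpace ℝ (Fin d)) = θ :=
    congrArg Subtype.val (stereo_left_inv hp (x := ⟨θ, by simpa using hθ⟩) hθp)
  rw [← hstereo]
  refine contract_complexDirection_stereoInvFun_eq_zero hp hpξ h fun hw => hθξ ?_
  rw [← hstereo, hw, stereoInvFun_apply]
  simp [hpξ]

end Stereographic

section RayMoments

variable {d m : ℕ}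

theorem continuous_complexDirection : Continuous (complexDirection (d := d)) := by
  unfold complexDirection
  fun_prop

theorem norm_complexDirection_le (θ : EuclideanSpace ℝ (Fin d)) :
    ‖complexDirection θ‖ ≤ max 1 ‖θ‖ := by
  refine (pi_norm_le_iff_of_nonneg (by positivity)).2 (Fin.cases ?_ fun j => ?_)
  · simp [complexDirection]
  · simpa [complexDirection] using Or.inr (PiLp.norm_apply_le θ j)

theorem Tensor.norm_contract_le {ι : Type} [Fintype ι] (t : Tensor ι m) (ζ : ι → ℂ) :
    ‖t.contract ζ‖ ≤ Fintype.card (Fin m → ι) * (‖t‖ * ‖ζ‖ ^ m) := by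
  have term_le (i : Fin m → ι) : ‖t i * ∏ j, ζ (i j)‖ ≤ ‖t‖ * ‖ζ‖ ^ m := by
    have prod_le : ∏ j, ‖ζ (i j)‖ ≤ ‖ζ‖ ^ m :=
      (Finset.prod_le_prod (fun _ _ => norm_nonneg _) fun j _ => norm_le_pi_norm ζ (i j)).trans_eq
        (by simp)
    rw [norm_mul, norm_prod]
    gcongr
    exact norm_le_pi_norm t i
  exact (norm_sum_le_of_le _ fun i _ => term_le i).trans_eq (by simp)

theorem Tensor.norm_contract_complexDirection_le (T : Tensor (Fin (d + 1)) m)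
    {θ : EuclideanSpace ℝ (Fin d)} (hθ : ‖θ‖ = 1) :
    ‖T.contract (complexDirection θ)‖ ≤ Fintype.card (Fin m → Fin (d + 1)) * ‖T‖ := by
  have hdirection : ‖complexDirection θ‖ ≤ 1 := by simpa [hθ] using norm_complexDirection_le θ
  refine (T.norm_contract_le _).trans ?_
  gcongr
  exact mul_le_of_le_one_right (norm_nonneg T) (pow_le_one₀ (norm_nonneg _) hdirection)

theorem aestronglyMeasurable_rayMoment
    {f : ℝ → EuclideanSpace ℝ (Fin d) → Tensor (Fin (d + 1)) m}
    (hf : AEStronglyMeasurable (f 0) volume) (α : ℕ)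
    (σ : Measure (Metric.sphere (0 : EuclideanSpace ℝ (Fin d)) 1)) [SFinite σ] :
    AEStronglyMeasurable (fun z : _ × Metric.sphere _ _ => rayMoment f z.1 α z.2.1)
      (volume.prod σ) := by
  have hpoint : AEStronglyMeasurable
      (fun z : (_ × Metric.sphere (0 : EuclideanSpace ℝ (Fin d)) 1) × ℝ =>
        f 0 (z.1.1 + z.2 • z.1.2.1)) ((volume.prod σ).prod (volume.restrict (Set.Ioi 0))) :=
    hf.comp_quasiMeasurePreserving
      (quasiMeasurePreserving_add_comp volume σ (volume.restrict (Set.Ioi (0 : ℝ)))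
        (g := fun w => w.2 • w.1.1) (by fun_prop))
  have hdirection : Continuous
      fun z : (EuclideanSpace ℝ (Fin d) × Metric.sphere (0 : EuclideanSpace ℝ (Fin d)) 1) × ℝ =>
        complexDirection z.1.2.1 :=
    continuous_complexDirection.comp (by fun_prop)
  have hcontract := Tensor.continuous_contract.comp_aestronglyMeasurable
    (hpoint.prodMk hdirection.aestronglyMeasurable)
  have hpow : Continuous
      fun z : (EuclideanSpace ℝ (Fin d) × Metric.sphere (0 : EuclideanSpace ℝ (Fin d)) 1) × ℝ =>
        (z.2 : ℂ) ^ α := by fun_prop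
  exact (hpow.aestronglyMeasurable.mul hcontract).integral_prod_right'

theorem ae_ae_rayMoment_eq_zero_comm
    {f : ℝ → EuclideanSpace ℝ (Fin d) → Tensor (Fin (d + 1)) m}
    (hf : AEStronglyMeasurable (f 0) volume) {U : Set (EuclideanSpace ℝ (Fin d))}
    (hU : MeasurableSet U) (σ : Measure (Metric.sphere (0 : EuclideanSpace ℝ (Fin d)) 1))
    [SFinite σ] {N : ℕ}
    (h : ∀ x₀ ∈ U, ∀ α ≤ N, ∀ᵐ θ ∂σ, rayMoment f x₀ α θ.1 = 0) :
    ∀ᵐ θ ∂σ, ∀ᵐ x₀, x₀ ∈ U → ∀ α ≤ N, rayMoment f x₀ α θ.1 = 0 := by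
  have hcomm (α : ℕ) (hα : α ≤ N) :
      ∀ᵐ θ ∂σ, ∀ᵐ x₀ ∂volume.restrict U, rayMoment f x₀ α θ.1 = 0 :=
    ae_ae_eq_zero_comm
      ((aestronglyMeasurable_rayMoment hf α σ).mono_ac
        (Measure.restrict_le_self.absolutelyContinuous.prod .rfl))
      ((ae_restrict_iff' hU).2 (ae_of_all _ fun x₀ hx₀ => h x₀ hx₀ α hα))
  filter_upwards [(ae_ball_iff (Set.to_countable (Set.Iic N))).2 hcomm] with θ hθ
  rw [← ae_restrict_iff' hU]
  exact (ae_ball_iff (Set.to_countable (Set.Iic N))).2 hθ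

end RayMoments

section FourierTransform

open scoped FourierTransform

variable {d m : ℕ} {f : ℝ → EuclideanSpace ℝ (Fin d) → Tensor (Fin (d + 1)) m} {R : ℝ}

theorem norm_contract_fourier_le_of_rayMoment_eq_zero (hf : Integrable (f 0)) (hR : 0 ≤ R)
    (hsupp : ∀ x, R < ‖x‖ → f 0 x = 0) {θ : EuclideanSpace ℝ (Fin d)} (hθ : ‖θ‖ = 1)
    (hmom : ∀ᵐ x₀, R < ‖x₀‖ → ∀ α ≤ m, rayMoment f x₀ α θ = 0) (ξ : EuclideanSpace ℝ (Fin d)) :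
    ‖(𝓕 (f 0) ξ).contract (complexDirection θ)‖ ≤
      ((2 * R + 1) * (2 * Real.pi * |inner ℝ θ ξ|)) ^ (m + 1) *
        Real.exp ((2 * R + 1) * (2 * Real.pi * ‖ξ‖)) *
          (Fintype.card (Fin m → Fin (d + 1)) * ∫ x, ‖f 0 x‖) := by
  let g (x : EuclideanSpace ℝ (Fin d)) : ℂ := Tensor.contractCLM (complexDirection θ) (f 0 x)
  have hg : Integrable g := (Tensor.contractCLM _).integrable_comp hf
  have g_supp (x) (hx : R < ‖x‖) : g x = 0 := by simp only [g, hsupp x hx, map_zero]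
  have g_mom : ∀ᵐ y, R < ‖y‖ → ∀ α ≤ m,
      ∫ r in Set.Ioi (0 : ℝ), (r : ℂ) ^ α * g (y + r • θ) = 0 := by
    simpa only [g, Tensor.contractCLM_apply, rayMoment] using hmom
  have integral_g_le : ∫ x, ‖g x‖ ≤ Fintype.card (Fin m → Fin (d + 1)) * ∫ x, ‖f 0 x‖ := by
    rw [← integral_const_mul]
    refine integral_mono hg.norm (hf.norm.const_mul _) fun x => ?_
    simpa only [g, Tensor.contractCLM_apply] using (f 0 x).norm_contract_complexDirection_le hθ
  have inner_le : |inner ℝ θ ξ| ≤ ‖ξ‖ := by simpa [hθ] using abs_real_inner_le_norm θ ξ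
  calc ‖(𝓕 (f 0) ξ).contract (complexDirection θ)‖ = ‖𝓕 g ξ‖ := by
        rw [fourier_clm_comp _ hf, Tensor.contractCLM_apply]
    _ ≤ _ := norm_fourier_le_of_moments_eq_zero hθ hg g_supp g_mom ξ
    _ ≤ _ := by gcongr

theorem vanishesOnComplexDirections_fourier_of_rayMoment_eq_zero (hd : 2 ≤ d)
    (hf : Integrable (f 0)) (hR : 0 ≤ R) (hsupp : ∀ x, R < ‖x‖ → f 0 x = 0)
    (hmom : ∀ᵐ θ : Metric.sphere (0 : EuclideanSpace ℝ (Fin d)) 1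
      ∂(volume : Measure (EuclideanSpace ℝ (Fin d))).toSphere,
      ∀ᵐ x₀, R < ‖x₀‖ → ∀ α ≤ m, rayMoment f x₀ α θ.1 = 0) (ξ : EuclideanSpace ℝ (Fin d)) :
    (𝓕 (f 0) ξ).VanishesOnComplexDirections := by
  let a : ℝ := (2 * R + 1) * (2 * Real.pi)
  let C : ℝ := Real.exp ((2 * R + 1) * (2 * Real.pi * ‖ξ‖)) *
    (Fintype.card (Fin m → Fin (d + 1)) * ∫ x, ‖f 0 x‖)
  let bounded : Set (EuclideanSpace ℝ (Fin d)) :=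
    {θ | ‖(𝓕 (f 0) ξ).contract (complexDirection θ)‖ ≤
      a ^ (m + 1) * C * |inner ℝ θ ξ| ^ (m + 1)}
  have isClosed_bounded : IsClosed bounded :=
    isClosed_le (Tensor.continuous_contract.comp
      (continuous_const.prodMk continuous_complexDirection)).norm (by fun_prop)
  refine Tensor.vanishesOnComplexDirections_of_norm_contract_le hd fun θ hθ =>
    forall_unit_of_ae_toSphere volume isClosed_bounded ?_ hθ
  filter_upwards [hmom] with θ hθmom
  refine (norm_contract_fourier_le_of_rayMoment_eq_zero hf hR hsupp
    (mem_sphere_zero_iff_norm.1 θ.2) hθmom ξ).trans_eq ?_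
  rw [mul_right_comm _ C, ← mul_pow]
  simp only [a, C, mul_assoc]

/-- The space of tensors on `ℝ × ℝ^d` whose contractions with all `e₁ + i θ`, `|θ| = 1`, vanish. -/
def Tensor.vanishingSubmodule (d m : ℕ) : Submodule ℂ (Tensor (Fin (d + 1)) m) where
  carrier := {T | T.VanishesOnComplexDirections}
  zero_mem' _ _ := zero_contract _
  add_mem' hS hT θ hθ := by
    rw [← contractCLM_apply, map_add, contractCLM_apply, contractCLM_apply, hS θ hθ, hT θ hθ,
      add_zero]
  smul_mem' c T hT θ hθ := by
    rw [← contractCLM_apply, map_smul, contractCLM_apply, hT θ hθ, smul_zero]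

theorem ae_mem_vanishingSubmodule (hd : 2 ≤ d) {K : Set (EuclideanSpace ℝ (Fin d))}
    (hK : Bornology.IsBounded K)
    {f : ℝ → EuclideanSpace ℝ (Fin d) → Tensor (Fin (d + 1)) m} (hf : IsTensorField K f)
    (hmom : ∀ᶠ x₀ in Bornology.cobounded (EuclideanSpace ℝ (Fin d)), ∀ α ≤ m,
      ∀ᵐ θ : Metric.sphere (0 : EuclideanSpace ℝ (Fin d)) 1
        ∂(volume : Measure (EuclideanSpace ℝ (Fin d))).toSphere,
        rayMoment f x₀ α θ.1 = 0) :
    ∀ᵐ x', f 0 x' ∈ Tensor.vanishingSubmodule d m := by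
  obtain ⟨R, hR⟩ := (Metric.hasBasis_cobounded_compl_closedBall
    (0 : EuclideanSpace ℝ (Fin d))).eventually_iff.1 (hmom.and (Bornology.isBounded_def.1 hK))
  have outside {x : EuclideanSpace ℝ (Fin d)} (hx : max R 0 < ‖x‖) :=
    hR.2 (show x ∈ (Metric.closedBall 0 R)ᶜ by simpa using (le_max_left R 0).trans_lt hx)
  refine ae_mem_of_forall_fourier_mem (Submodule.closed_of_finiteDimensional _) hf.integrable
    (vanishesOnComplexDirections_fourier_of_rayMoment_eq_zero hd hf.integrable (le_max_right R 0)
      (fun x hx => hf.support 0 x (outside hx).2) ?_)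
  exact ae_ae_rayMoment_eq_zero_comm hf.integrable.aestronglyMeasurable
    (isOpen_lt continuous_const continuous_norm).measurableSet _ fun x hx => (outside hx).1

end FourierTransform

section AssembledField

namespace Tensor

theorem isLinearMap_iDelta {ι : Type} [DecidableEq ι] {m : ℕ} :
    IsLinearMap ℂ (iDelta : Tensor ι m → Tensor ι (m + 2)) where
  map_add s t := by
    funext i
    simp only [iDelta, Pi.add_apply, add_mul, mul_add, Finset.sum_add_distrib]
  map_smul c t := by
    funext i
    simp [iDelta, Finset.mul_sum, mul_left_comm]

theorem isLinearMap_iDeltaPow {ι : Type} [DecidableEq ι] {m : ℕ} (l : ℕ) :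
    IsLinearMap ℂ fun t : Tensor ι m => t.iDeltaPow l := by
  induction l with
  | zero => exact LinearMap.id.isLinear
  | succ l ih => exact ((isLinearMap_iDelta.mk' _).comp (ih.mk' _)).isLinear

variable {d m : ℕ}

theorem isLinearMap_tilde (q : ℕ) : IsLinearMap ℂ fun T : Tensor (Fin (d + 1)) m => T.tilde q where
  map_add _ _ := funext fun _ => mul_add _ _ _
  map_smul _ _ := funext fun _ => mul_left_comm _ _ _

theorem isLinearMap_alternatingSum (p : ℕ) :
    IsLinearMap ℂ fun T : Tensor (Fin (d + 1)) m => T.alternatingSum p where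
  map_add S T := by
    funext i
    simp [alternatingSum, (isLinearMap_tilde _).map_add, (isLinearMap_iDeltaPow _).map_add, mul_add,
      Finset.sum_add_distrib]
  map_smul c T := by
    funext i
    simp [alternatingSum, (isLinearMap_tilde _).map_smul, (isLinearMap_iDeltaPow _).map_smul,
      Finset.mul_sum, mul_left_comm]

theorem isLinearMap_assemble_alternatingSum (k : ℕ) :
    IsLinearMap ℂ fun T : Tensor (Fin (d + 1)) m => assemble T.alternatingSum k where
  map_add S T := by
    funext i
    simp [assemble, evalList, (isLinearMap_alternatingSum _).map_add, mul_add]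
  map_smul c T := by
    funext i
    simp [assemble, evalList, (isLinearMap_alternatingSum _).map_smul, mul_left_comm]

end Tensor

theorem IsTensorField.assemble {d m : ℕ} {K : Set (EuclideanSpace ℝ (Fin d))}
    {f : ℝ → EuclideanSpace ℝ (Fin d) → Tensor (Fin (d + 1)) m} (hf : IsTensorField K f) (k : ℕ) :
    IsTensorField K fun x₁ x' => Tensor.assemble (f x₁ x').alternatingSum k where
  symmetric x₁ x' := Tensor.assemble_isSymmetric (hf.symmetric x₁ x').alternatingSum k
  support x₁ x' hx := by
    rw [hf.support x₁ x' hx]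
    exact (Tensor.isLinearMap_assemble_alternatingSum k).map_zero
  integrable :=
    ((Tensor.isLinearMap_assemble_alternatingSum k).mk' _).toContinuousLinearMap.integrable_comp
      hf.integrable

end AssembledField

theorem mainTheorem7_general (d m : ℕ) (hd : 2 ≤ d)
    (K : Set (EuclideanSpace ℝ (Fin d))) (hK : Bornology.IsBounded K)
    (f : ℝ → EuclideanSpace ℝ (Fin d) → Tensor (Fin (d + 1)) m)
    (hf : IsTensorField K f)
    (hmom : ∀ᶠ x₀ in Bornology.cobounded (EuclideanSpace ℝ (Fin d)), ∀ α ≤ m,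
      ∀ᵐ θ : Metric.sphere (0 : EuclideanSpace ℝ (Fin d)) 1
        ∂(volume : Measure (EuclideanSpace ℝ (Fin d))).toSphere,
        rayMoment f x₀ α θ.1 = 0) :
    (m ≤ 1 →
      (∀ᵐ x' ∂(volume : Measure (EuclideanSpace ℝ (Fin d))), f 0 x' = 0) ∧
      ∀ x', ContinuousAt (f 0) x' → f 0 x' = 0) ∧
    (∀ (k : ℕ) (hk : m = k + 2),
      ∃ v : ℝ → EuclideanSpace ℝ (Fin d) → Tensor (Fin (d + 1)) k,
        IsTensorField K v ∧
        (∀ᵐ x' ∂(volume : Measure (EuclideanSpace ℝ (Fin d))),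
          ∀ i, f 0 x' i = (v 0 x').iDelta (i ∘ Fin.cast hk.symm)) ∧
        (∀ x', ContinuousAt (f 0) x' →
          ∀ i, f 0 x' i = (v 0 x').iDelta (i ∘ Fin.cast hk.symm)) ∧
        ∀ x₁ x', ∀ p ≤ k, ∀ i : Fin p → Fin d,
          v x₁ x' (padIndex k i) = (k.choose (k - p) : ℂ)⁻¹ * (f x₁ x').alternatingSum p i) := by
  have : NeZero d := ⟨by omega⟩
  have vanish_ae := ae_mem_vanishingSubmodule hd hK hf hmom
  have vanish_of_continuousAt (x') (hx : ContinuousAt (f 0) x') :=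
    mem_of_ae_mem_of_continuousAt (Submodule.closed_of_finiteDimensional _) vanish_ae hx
  refine ⟨fun hm => ?_, fun k hk => ⟨_, hf.assemble k, ?_⟩⟩
  · have eq_zero (x') := (hf.symmetric 0 x').eq_zero_of_vanishesOnComplexDirections hm
    exact ⟨vanish_ae.mono eq_zero, fun x' hx => eq_zero x' (vanish_of_continuousAt x' hx)⟩
  · subst hk
    have eq_iDelta (x') (h : f 0 x' ∈ Tensor.vanishingSubmodule d (k + 2)) :=
      congrFun ((hf.symmetric 0 x').eq_iDelta_assemble h)
    exact ⟨vanish_ae.mono eq_iDelta, fun x' hx => eq_iDelta x' (vanish_of_continuousAt x' hx),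
      fun x₁ x' p hp i => Tensor.assemble_padIndex hp i⟩

theorem mainTheorem7 (d m : ℕ) (hd : 2 ≤ d)
    (K : Set (EuclideanSpace ℝ (Fin d))) (hK : IsCompact K)
    (f : ℝ → EuclideanSpace ℝ (Fin d) → Tensor (Fin (d + 1)) m)
    (hf : IsTensorField K f)
    (hmom : ∀ x₀ ∉ K, ∀ α ≤ m,
      ∀ᵐ θ : Metric.sphere (0 : EuclideanSpace ℝ (Fin d)) 1
        ∂(volume : Measure (EuclideanSpace ℝ (Fin d))).toSphere,
        rayMoment f x₀ α θ.1 = 0) :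
    (m ≤ 1 →
      (∀ᵐ x' ∂(volume : Measure (EuclideanSpace ℝ (Fin d))), f 0 x' = 0) ∧
      ∀ x', ContinuousAt (f 0) x' → f 0 x' = 0) ∧
    (∀ (k : ℕ) (hk : m = k + 2),
      ∃ v : ℝ → EuclideanSpace ℝ (Fin d) → Tensor (Fin (d + 1)) k,
        IsTensorField K v ∧
        (∀ᵐ x' ∂(volume : Measure (EuclideanSpace ℝ (Fin d))),
          ∀ i, f 0 x' i = (v 0 x').iDelta (i ∘ Fin.cast hk.symm)) ∧
        (∀ x', ContinuousAt (f 0) x' →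
          ∀ i, f 0 x' i = (v 0 x').iDelta (i ∘ Fin.cast hk.symm)) ∧
        ∀ x₁ x', ∀ p ≤ k, ∀ i : Fin p → Fin d,
          v x₁ x' (padIndex k i) = (k.choose (k - p) : ℂ)⁻¹ * (f x₁ x').alternatingSum p i) :=
  mainTheorem7_general d m hd K hK.isBounded f hf
    (Filter.mem_of_superset (Bornology.isBounded_def.1 hK.isBounded) hmom)
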